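/- For $n\ge 0$ let $\mathbb{B}^n$ be the open unit ball of $\mathbb{C}^n$, let $\mathrm{Aut}(\mathbb{B}^n)$ be its group of holomorphic automorphisms, and regard the unitary group $\mathbf{U}(n)$ as a subgroup of $\mathrm{Aut}(\mathbb{B}^n)$. For a map $f:\mathbb{B}^n\to\mathbb{B}^N$, the Hermitian invariant group $\Gamma_f$ is the group of all $\gamma\in\mathrm{Aut}(\mathbb{B}^n)$ for which there is some $\psi\in\mathrm{Aut}(\mathbb{B}^N)$ with $f\circ\gamma=\psi\circ f$. Maps $f,g:\mathbb{B}^n\to\mathbb{B}^N$ are spherically equivalent if $f=\chi\circ g\circ\varphi$ for some $\varphi\in\mathrm{Aut}(\mathbb{B}^n)$ and $\chi\in\mathrm{Aut}(\mathbb{B}^N)$. For an integer $m\ge 0$, $z^{\otimes m}$ denotes the tensor power with values in the $m$-th symmetric power of $\mathbb{C}^n$, written in orthonormal coordinates; that is, the map with the $\binom{n+m-1}{m}$ components $\sqrt{m!/\alpha!}\;z^\alpha$, $|\alpha|=m$ (so $\|z^{\otimes m}\|^2=\|z\|^{2m}$, and $z^{\otimes 0}=1$). **Theorem 5.2.** Let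 $N\ge n\ge 1$ and let $f:\mathbb{B}^n\to\mathbb{B}^N$ be a rational holomorphic proper map. Then $\Gamma_f$ contains a conjugate $\varphi\circ\mathbf{U}(n)\circ\varphi^{-1}$, $\varphi\in\mathrm{Aut}(\mathbb{B}^n)$, of $\mathbf{U}(n)$ if and only if there are an integer $k\ge 1$, integers $0\le m_1<m_2<\cdots<m_k$ and $\lambda=(\lambda_1,\dots,\lambda_k)\in\mathbb{C}^k$ with $\sum_j|\lambda_j|^2=1$ such that $f$ is spherically equivalent to a map $\mathbb{B}^n\to\mathbb{B}^N$ of the form $$z\mapsto \lambda_1z^{\otimes m_1}\oplus\cdots\oplus\lambda_kz^{\otimes m_k}\oplus 0,$$ where the components of the summands occupy distinct coordinates of $\mathbb{C}^N$ and the remaining coordinates are $0$. Moreover, in this case the integers $m_j$ and the numbers $\lambda_j$ can be chosen with all $\lambda_j$ real and positive. -/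

import Mathlib

namespace CBall

/-- The Hermitian space `ℂⁿ`. -/
abbrev E (n : ℕ) : Type := EuclideanSpace ℂ (Fin n)

/-- The open unit ball `𝔹ⁿ` of `ℂⁿ`, as a type. -/
abbrev Ball (n : ℕ) : Type := ↥(Metric.ball (0 : E n) 1)

/-- A map of `𝔹ⁿ` into `𝔹ᴺ` is holomorphic on `𝔹ⁿ`. (A map out of `𝔹ⁿ` is the restriction of
some function on `ℂⁿ`, whose values off the open ball are irrelevant.) -/
def Holomorphic {n N : ℕ} (f : Ball n → Ball N) : Prop :=
  ∃ F : E n → E N, DifferentiableOn ℂ F (Metric.ball 0 1) ∧ ∀ z : Ball n, F z = (f z : E N)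

theorem Holomorphic.id {n : ℕ} : Holomorphic (fun z : Ball n => z) :=
  ⟨fun z => z, differentiableOn_id, fun _ => rfl⟩

theorem Holomorphic.comp {n m k : ℕ} {g : Ball m → Ball k} {f : Ball n → Ball m}
    (hg : Holomorphic g) (hf : Holomorphic f) : Holomorphic (fun z => g (f z)) := by
  obtain ⟨G, hG, hGg⟩ := hg
  obtain ⟨F, hF, hFf⟩ := hf
  refine ⟨fun z => G (F z), hG.comp hF ?_, fun z => ?_⟩
  · intro z hz
    have h := hFf ⟨z, hz⟩
    simp only at h
    rw [h]
    exact (f ⟨z, hz⟩).2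
  · simp only [hFf, hGg]

/-- The group `Aut(𝔹ⁿ)` of holomorphic automorphisms of the ball, under composition. -/
def Aut (n : ℕ) : Subgroup (Equiv.Perm (Ball n)) where
  carrier := {φ | Holomorphic φ ∧ Holomorphic φ.symm}
  one_mem' := ⟨Holomorphic.id, Holomorphic.id⟩
  mul_mem' := fun ha hb => ⟨ha.1.comp hb.1, hb.2.comp ha.2⟩
  inv_mem' := fun ha => ⟨ha.2, ha.1⟩

/-- The permutation of the ball given by a unitary transformation of `ℂⁿ`. -/
noncomputable def unitaryPerm {n : ℕ} (U : E n ≃ₗᵢ[ℂ] E n) : Equiv.Perm (Ball n) where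
  toFun z := ⟨U z, by have h := z.2; rw [mem_ball_zero_iff] at h ⊢; rwa [U.norm_map]⟩
  invFun z := ⟨U.symm z, by have h := z.2; rw [mem_ball_zero_iff] at h ⊢; rwa [U.symm.norm_map]⟩
  left_inv z := by simp
  right_inv z := by simp

theorem holomorphic_unitaryPerm {n : ℕ} (U : E n ≃ₗᵢ[ℂ] E n) : Holomorphic (unitaryPerm U) :=
  ⟨U, U.toContinuousLinearEquiv.differentiable.differentiableOn, fun _ => rfl⟩

/-- The inclusion of the unitary group of `ℂⁿ` into `Aut(𝔹ⁿ)`. -/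
noncomputable def unitaryHom (n : ℕ) : (E n ≃ₗᵢ[ℂ] E n) →* Aut n where
  toFun U := ⟨unitaryPerm U, holomorphic_unitaryPerm U, holomorphic_unitaryPerm U.symm⟩
  map_one' := rfl
  map_mul' _ _ := rfl

/-- `U(n)` as a subgroup of `Aut(𝔹ⁿ)`. -/
noncomputable def unitarySubgroup (n : ℕ) : Subgroup (Aut n) := (unitaryHom n).range

/-- The Hermitian invariant group `Γ_f`: all `γ ∈ Aut(𝔹ⁿ)` for which there is `ψ ∈ Aut(𝔹ᴺ)`
with `f ∘ γ = ψ ∘ f`. -/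
def hermitianInvariantGroup {n N : ℕ} (f : Ball n → Ball N) : Subgroup (Aut n) where
  carrier := {γ | ∃ ψ : Aut N, ∀ z, f (γ.1 z) = ψ.1 (f z)}
  one_mem' := ⟨1, fun _ => rfl⟩
  mul_mem' := by
    rintro a b ⟨ψ, hψ⟩ ⟨χ, hχ⟩
    refine ⟨ψ * χ, fun z => ?_⟩
    change f (a.1 (b.1 z)) = ψ.1 (χ.1 (f z))
    rw [hψ, hχ]
  inv_mem' := by
    rintro a ⟨ψ, hψ⟩
    refine ⟨ψ⁻¹, fun z => ?_⟩
    change f (a.1.symm z) = ψ.1.symm (f z)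
    rw [Equiv.eq_symm_apply, ← hψ, Equiv.apply_symm_apply]

/-- `Γ` contains `φ ∘ U(n) ∘ φ⁻¹` for some `φ ∈ Aut(𝔹ⁿ)`. -/
def ContainsConjugateOfUnitary {n : ℕ} (Γ : Subgroup (Aut n)) : Prop :=
  ∃ φ : Aut n, (unitarySubgroup n).map (MulAut.conj φ).toMonoidHom ≤ Γ

/-- `f` is the restriction to `𝔹ⁿ` of a rational map `p / q` without poles in `𝔹ⁿ`. -/
def IsRational {n N : ℕ} (f : Ball n → Ball N) : Prop :=
  ∃ (p : Fin N → MvPolynomial (Fin n) ℂ) (q : MvPolynomial (Fin n) ℂ), ∀ z : Ball n,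
    MvPolynomial.eval (fun i => (z : E n) i) q ≠ 0 ∧
    ∀ i, (f z : E N) i =
      MvPolynomial.eval (fun i => (z : E n) i) (p i) / MvPolynomial.eval (fun i => (z : E n) i) q

/-- Spherical equivalence: `f = χ ∘ g ∘ φ` with `φ ∈ Aut(𝔹ⁿ)` and `χ ∈ Aut(𝔹ᴺ)`. -/
def SphericallyEquivalent {n N : ℕ} (f g : Ball n → Ball N) : Prop :=
  ∃ (φ : Aut n) (χ : Aut N), ∀ z, f z = χ.1 (g (φ.1 z))

/-- The tensor power `z^{⊗m}`, written in the orthonormal monomial basis of the symmetric power: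
its components are `√(m! / α!) z^α`, one for each multi-index `α` with `|α| = m`; a multi-index
is encoded as the multiset of size `m` in which `i` occurs `α i` times. For `n = m = 2` this is
`(z₁², √2 z₁z₂, z₂²)`, and for `m = 0` it is the constant `1`. -/
noncomputable def tensorPower {n : ℕ} (m : ℕ) (z : E n) : EuclideanSpace ℂ (Sym (Fin n) m) :=
  WithLp.toLp 2 fun s =>
    (Real.sqrt ((s : Multiset (Fin n)).countPerms : ℝ) : ℂ) *
      ((s : Multiset (Fin n)).map fun i => z i).prod

/-- The map `λ₁ z^{⊗m₁} ⊕ ⋯ ⊕ λ_k z^{⊗m_k} ⊕ 0` into `ℂᴺ`. The injection `e` says which coordinate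
of `ℂᴺ` holds which component of which summand; the other coordinates are `0`. -/
noncomputable def tensorSum {n N k : ℕ} (m : Fin k → ℕ) (lam : Fin k → ℂ)
    (e : (Σ j : Fin k, Sym (Fin n) (m j)) ↪ Fin N) (z : E n) : E N :=
  WithLp.toLp 2 <|
    Function.extend e (fun s => lam s.1 * tensorPower (m s.1) z s.2) (fun _ => 0)

/-- `g : 𝔹ⁿ → 𝔹ᴺ` is the juxtaposition `J_λ(z^{⊗m₁}, …, z^{⊗m_k}) ⊕ 0`, where `‖λ‖ = 1`. -/
def IsTensorJuxtaposition {n N k : ℕ} (m : Fin k → ℕ) (lam : Fin k → ℂ)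
    (g : Ball n → Ball N) : Prop :=
  ∑ j, ‖lam j‖ ^ 2 = 1 ∧
    ∃ e : (Σ j : Fin k, Sym (Fin n) (m j)) ↪ Fin N, ∀ z : Ball n, (g z : E N) = tensorSum m lam e z

end CBall

/-! The whole argument runs through Gram kernels: in finite dimension, two maps with the same kernel
`⟪g z, g w⟫` differ by a unitary map of the target. The kernel of a tensor juxtaposition is `∑
|λ_j|² ⟪z, w⟫ ^ m_j` (`inner_tensorSum`). It is `U(n)`-invariant, so each source unitary is matched
by a target unitary; this gives one direction and needs no properness.

Conversely, compose `f` with automorphisms to get `h` with `h 0 = 0` and `U(n) ≤ Γ_h`. The target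
automorphism matching a unitary then fixes `0`, so by the Schwarz lemma it preserves norms, and `‖h
z‖` depends only on `‖z‖`. On a complex disc through `0` the Taylor coefficients of `h` are pairwise
orthogonal, hence only finitely many are nonzero, and `‖h z‖² = ∑ b_j² ‖z‖^(2j)`
(`exists_norm_sq_eq_sum`). Properness forces `∑ b_j² = 1`. Polarization turns the norm identity into
the kernel of a juxtaposition with weights `b_j > 0` (`exists_inner_eq_sum`). A dimension count
(`card_sigma_sym_le`) shows that this juxtaposition fits into `ℂᴺ`, and equality of kernels supplies
the final unitary. -/

namespace CBall

open Set Metric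

/-! ### Gram matrices and unitary equivalence. -/

section Gram

variable {ι V W : Type*} [NormedAddCommGroup V] [InnerProductSpace ℂ V]
  [NormedAddCommGroup W] [InnerProductSpace ℂ W]

/-- Families with the same Gram matrix are related by a linear isometry of their spans. -/
theorem exists_linearIsometry_span {a : ι → V} {b : ι → W}
    (h : ∀ x y, inner ℂ (a x) (a y) = inner ℂ (b x) (b y)) :
    ∃ L : Submodule.span ℂ (range a) →ₗᵢ[ℂ] W,
      ∀ x, L ⟨a x, Submodule.subset_span ⟨x, rfl⟩⟩ = b x := by
  have hn : ∀ l : ι →₀ ℂ,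
      ‖Finsupp.linearCombination ℂ a l‖ = ‖Finsupp.linearCombination ℂ b l‖ := by
    intro l
    rw [@norm_eq_sqrt_re_inner ℂ, @norm_eq_sqrt_re_inner ℂ]
    simp only [Finsupp.linearCombination_apply,
      Finsupp.sum, inner_smul_left, inner_smul_right, sum_inner, inner_sum, h]
  have hr : Submodule.span ℂ (range a) = LinearMap.range (Finsupp.linearCombination ℂ a) :=
    (Finsupp.range_linearCombination ℂ).symm
  choose s hs using fun x : Submodule.span ℂ (range a) =>
    (show (x : V) ∈ LinearMap.range (Finsupp.linearCombination ℂ a) from hr ▸ x.2)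
  -- The representation `s x` is an arbitrary choice; by `hn` the image does not depend on it.
  have hw : ∀ l l' : ι →₀ ℂ,
      Finsupp.linearCombination ℂ a l = Finsupp.linearCombination ℂ a l' →
      Finsupp.linearCombination ℂ b l = Finsupp.linearCombination ℂ b l' := by
    intro l l' hl
    rw [← sub_eq_zero, ← map_sub, ← norm_eq_zero, ← hn, map_sub, hl, sub_self, norm_zero]
  refine ⟨⟨⟨⟨fun x => Finsupp.linearCombination ℂ b (s x), fun x y => ?_⟩, fun c x => ?_⟩,
    fun x => ?_⟩, fun x => ?_⟩
  · rw [← map_add]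
    apply hw
    rw [map_add, hs, hs, hs]; rfl
  · rw [← map_smul]
    apply hw
    rw [map_smul, hs, hs]; rfl
  · change ‖Finsupp.linearCombination ℂ b (s x)‖ = _
    rw [← hn, hs]; rfl
  · change Finsupp.linearCombination ℂ b (s _) = _
    rw [hw _ (Finsupp.single x 1) (by rw [hs]; simp)]
    simp

theorem exists_linearIsometryEquiv_of_inner_eq [FiniteDimensional ℂ V] {a b : ι → V}
    (h : ∀ x y, inner ℂ (a x) (a y) = inner ℂ (b x) (b y)) :
    ∃ U : V ≃ₗᵢ[ℂ] V, ∀ x, U (a x) = b x := by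
  obtain ⟨L, hL⟩ := exists_linearIsometry_span h
  refine ⟨L.extend.toLinearIsometryEquiv rfl, fun x => ?_⟩
  rw [LinearIsometry.toLinearIsometryEquiv_apply, ← hL]
  exact L.extend_apply ⟨a x, _⟩

/-- The unitary group acts transitively on spheres. -/
theorem exists_linearIsometryEquiv_of_norm_eq [FiniteDimensional ℂ V] {x y : V}
    (h : ‖x‖ = ‖y‖) : ∃ U : V ≃ₗᵢ[ℂ] V, U x = y := by
  obtain ⟨U, hU⟩ := exists_linearIsometryEquiv_of_inner_eq (ι := Unit) (a := fun _ => x)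
    (b := fun _ => y) (fun _ _ => by
      rw [inner_self_eq_norm_sq_to_K, inner_self_eq_norm_sq_to_K, h])
  exact ⟨U, hU ()⟩

end Gram

/-! ### Polarization of norm identities for holomorphic maps. -/

section Polarization

variable {V W : Type*} [NormedAddCommGroup V] [InnerProductSpace ℂ V]
  [NormedAddCommGroup W] [InnerProductSpace ℂ W]

theorem hasDerivAt_comp_add_ofReal_mul {Ω : Set ℂ} (hΩ : IsOpen Ω) {A : ℂ → V}
    (hA : DifferentiableOn ℂ A Ω) {t : ℂ} (ht : t ∈ Ω) (c : ℂ) :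
    HasDerivAt (fun r : ℝ => A (t + r * c)) (c • deriv A t) 0 := by
  have h1 : HasDerivAt A (deriv A t) (t + ((0 : ℝ) : ℂ) * c) := by
    simpa using (hA.differentiableAt (hΩ.mem_nhds ht)).hasDerivAt
  have h2 : HasDerivAt (fun r : ℝ => t + (r : ℂ) * c) c 0 := by
    simpa using ((Complex.ofRealCLM.hasDerivAt (x := (0 : ℝ))).mul_const c).const_add t
  exact h1.scomp (0 : ℝ) h2

/-- The pairing is antiholomorphic in its first slot. Real derivatives in the directions `1` and `I`
therefore separate `∂/∂t`, which sees only the second slot, from `∂/∂t̄`. -/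
theorem inner_deriv_eq {Ω : Set ℂ} (hΩ : IsOpen Ω) {F F₁ : ℂ → V} {G G₁ : ℂ → W}
    (hF : DifferentiableOn ℂ F Ω) (hF₁ : DifferentiableOn ℂ F₁ Ω)
    (hG : DifferentiableOn ℂ G Ω) (hG₁ : DifferentiableOn ℂ G₁ Ω)
    (h : ∀ t ∈ Ω, inner ℂ (F t) (F₁ t) = inner ℂ (G t) (G₁ t)) :
    ∀ t ∈ Ω, inner ℂ (F t) (deriv F₁ t) = inner ℂ (G t) (deriv G₁ t) := by
  intro t ht
  have key (c : ℂ) : inner ℂ (F t) (c • deriv F₁ t) + inner ℂ (c • deriv F t) (F₁ t) =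
      inner ℂ (G t) (c • deriv G₁ t) + inner ℂ (c • deriv G t) (G₁ t) := by
    have h1 := HasDerivAt.inner ℂ (hasDerivAt_comp_add_ofReal_mul hΩ hF ht c)
      (hasDerivAt_comp_add_ofReal_mul hΩ hF₁ ht c)
    have h2 := HasDerivAt.inner ℂ (hasDerivAt_comp_add_ofReal_mul hΩ hG ht c)
      (hasDerivAt_comp_add_ofReal_mul hΩ hG₁ ht c)
    simp only [Complex.ofReal_zero, zero_mul, add_zero] at h1 h2
    refine h1.unique (h2.congr_of_eventuallyEq ?_)
    have hc : ContinuousAt (fun r : ℝ => t + (r : ℂ) * c) 0 := by fun_prop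
    filter_upwards [hc.preimage_mem_nhds (hΩ.mem_nhds (by simpa using ht))] with r hr
    exact h _ hr
  have k1 := key 1
  have k2 := key Complex.I
  simp only [one_smul, inner_smul_left, inner_smul_right, Complex.conj_I] at k1 k2
  linear_combination (1 / 2 : ℂ) * k1 - Complex.I / 2 * k2 +
    (1 / 2 : ℂ) * (inner ℂ (F t) (deriv F₁ t) - inner ℂ (deriv F t) (F₁ t)
      - inner ℂ (G t) (deriv G₁ t) + inner ℂ (deriv G t) (G₁ t)) * Complex.I_sq

theorem iteratedDeriv_comp_mul_left (f : ℂ → V) (c : ℂ) (k : ℕ) :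
    iteratedDeriv k (fun t => f (c * t)) = fun t => c ^ k • iteratedDeriv k f (c * t) := by
  induction k with
  | zero => simp
  | succ k ih =>
    funext t
    rw [iteratedDeriv_succ, ih, deriv_fun_const_smul_field, deriv_comp_mul_left,
      iteratedDeriv_succ, smul_smul, pow_succ]

variable [CompleteSpace V] [CompleteSpace W]

theorem differentiableOn_iteratedDeriv {Ω : Set ℂ} (hΩ : IsOpen Ω) {F : ℂ → V}
    (hF : DifferentiableOn ℂ F Ω) (k : ℕ) : DifferentiableOn ℂ (iteratedDeriv k F) Ω := by
  induction k with
  | zero => simpa using hF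
  | succ k ih => rw [iteratedDeriv_succ]; exact ih.deriv hΩ

theorem inner_iteratedDeriv_eq {Ω : Set ℂ} (hΩ : IsOpen Ω) {F : ℂ → V} {G : ℂ → W}
    (hF : DifferentiableOn ℂ F Ω) (hG : DifferentiableOn ℂ G Ω)
    (h : ∀ t ∈ Ω, ‖F t‖ = ‖G t‖) (j k : ℕ) :
    ∀ t ∈ Ω, inner ℂ (iteratedDeriv j F t) (iteratedDeriv k F t) =
      inner ℂ (iteratedDeriv j G t) (iteratedDeriv k G t) := by
  have dF := differentiableOn_iteratedDeriv hΩ hF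
  have dG := differentiableOn_iteratedDeriv hΩ hG
  have h0 (j : ℕ) : ∀ t ∈ Ω, inner ℂ (iteratedDeriv j F t) (F t) =
      inner ℂ (iteratedDeriv j G t) (G t) := by
    induction j with
    | zero =>
      intro t ht
      simp only [iteratedDeriv_zero]
      rw [inner_self_eq_norm_sq_to_K, inner_self_eq_norm_sq_to_K, h t ht]
    | succ j ih =>
      intro t ht
      rw [iteratedDeriv_succ, iteratedDeriv_succ, ← inner_conj_symm, ← inner_conj_symm (deriv _ t)]
      congr 1
      refine inner_deriv_eq hΩ hF (dF j) hG (dG j) (fun s hs => ?_) t ht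
      rw [← inner_conj_symm, ih s hs, inner_conj_symm]
  induction k with
  | zero => simpa using h0 j
  | succ k ih =>
    rw [iteratedDeriv_succ, iteratedDeriv_succ]
    exact inner_deriv_eq hΩ (dF j) (dF k) (dG j) (dG k) ih

/-- Polarization of an identity between the norms of two holomorphic curves. -/
theorem inner_eq_of_norm_eq {Ω : Set ℂ} (hΩ : IsOpen Ω) (hc : IsPreconnected Ω)
    {F : ℂ → V} {G : ℂ → W}
    (hF : DifferentiableOn ℂ F Ω) (hG : DifferentiableOn ℂ G Ω)
    (h : ∀ t ∈ Ω, ‖F t‖ = ‖G t‖) {s t : ℂ} (hs : s ∈ Ω) (ht : t ∈ Ω) :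
    inner ℂ (F s) (F t) = inner ℂ (G s) (G t) := by
  have hd : DifferentiableOn ℂ (fun x => inner ℂ (F s) (F x)) Ω :=
    (innerSL ℂ (F s)).differentiable.comp_differentiableOn hF
  have hd' : DifferentiableOn ℂ (fun x => inner ℂ (G s) (G x)) Ω :=
    (innerSL ℂ (G s)).differentiable.comp_differentiableOn hG
  refine (hd.analyticOnNhd hΩ).eqOn_of_preconnected_of_eventuallyEq (hd'.analyticOnNhd hΩ)
    hc hs ?_ ht
  obtain ⟨r, hr, hb⟩ := Metric.isOpen_iff.1 hΩ s hs
  -- Near `s` both sides are power series in `x`, with coefficients `⟪F s, F⁽ⁿ⁾ s⟫` and `⟪G s, G⁽ⁿ⁾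
  -- s⟫`.
  filter_upwards [ball_mem_nhds s hr] with x hx
  have h1 := (innerSL ℂ (F s)).hasSum (Complex.hasSum_taylorSeries_on_ball (hF.mono hb) hx)
  have h2 := (innerSL ℂ (G s)).hasSum (Complex.hasSum_taylorSeries_on_ball (hG.mono hb) hx)
  refine h1.unique (h2.congr_fun ?_)
  intro n
  have := inner_iteratedDeriv_eq hΩ hF hG h 0 n s hs
  simp only [iteratedDeriv_zero] at this
  simp [this]

/-- Polarization of an identity between the norms of two holomorphic maps on a convex set. -/
theorem inner_eq_of_norm_eq_of_convex {X : Type*} [NormedAddCommGroup X] [NormedSpace ℂ X]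
    {s : Set X} (hs : IsOpen s) (hc : Convex ℝ s) {F : X → V} {G : X → W}
    (hF : DifferentiableOn ℂ F s) (hG : DifferentiableOn ℂ G s)
    (h : ∀ x ∈ s, ‖F x‖ = ‖G x‖) {x y : X} (hx : x ∈ s) (hy : y ∈ s) :
    inner ℂ (F x) (F y) = inner ℂ (G x) (G y) := by
  -- Restrict to the complex line through `x` and `y`, which meets `s` in a convex set.
  have hl : Differentiable ℂ (fun t : ℂ => x + t • (y - x)) := by fun_prop
  have hcv : Convex ℝ ((fun t : ℂ => x + t • (y - x)) ⁻¹' s) := by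
    intro a ha b hb p q hp hq hpq
    have := hc ha hb hp hq hpq
    simp only [mem_preimage] at this ⊢
    convert this using 1
    have : x = (p + q) • x := by rw [hpq, one_smul]
    nth_rw 1 [this]
    simp only [smul_add, add_smul, smul_assoc]
    abel
  have := inner_eq_of_norm_eq (hs.preimage hl.continuous) hcv.isPreconnected
    (hF.comp hl.differentiableOn fun _ ht => ht) (hG.comp hl.differentiableOn fun _ ht => ht)
    (fun t ht => h _ ht) (s := 0) (t := 1) (by simpa using hx) (by simpa using hy)
  simpa using this

/-- The Taylor coefficients of a rotation invariant holomorphic curve are orthogonal. -/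
theorem inner_iteratedDeriv_eq_zero {F : ℂ → V} (hF : DifferentiableOn ℂ F (ball 0 1))
    (h : ∀ c : ℂ, ‖c‖ = 1 → ∀ t ∈ ball (0 : ℂ) 1, ‖F (c * t)‖ = ‖F t‖) {j k : ℕ} (hjk : j ≠ k) :
    inner ℂ (iteratedDeriv j F 0) (iteratedDeriv k F 0) = 0 := by
  wlog hlt : j < k generalizing j k
  · rw [← inner_conj_symm, this hjk.symm (by omega), map_zero]
  obtain ⟨d, rfl⟩ := Nat.exists_eq_add_of_lt hlt
  -- With `k - j = d + 1`, this `c` satisfies `conj (c ^ j) * c ^ k = -1`, so rotation by `c` makes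
  -- the inner product equal to its own negative.
  set c : ℂ := Complex.exp (Real.pi / (d + 1 : ℕ) * Complex.I) with hcdef
  have hc : ‖c‖ = 1 := by
    rw [hcdef, show (Real.pi / (d + 1 : ℕ) * Complex.I : ℂ) =
      ((Real.pi / (d + 1 : ℕ) : ℝ) : ℂ) * Complex.I by push_cast; rfl]
    exact Complex.norm_exp_ofReal_mul_I _
  have hcd : c ^ (d + 1) = -1 := by
    rw [hcdef, ← Complex.exp_nat_mul, ← Complex.exp_pi_mul_I]
    congr 1
    have : ((d + 1 : ℕ) : ℂ) ≠ 0 := by exact_mod_cast Nat.succ_ne_zero d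
    field_simp
  have hmaps : MapsTo (fun t : ℂ => c * t) (ball 0 1) (ball 0 1) := by
    intro t ht
    simpa [hc] using ht
  have hFc : DifferentiableOn ℂ (fun t => F (c * t)) (ball 0 1) :=
    hF.comp (by fun_prop) hmaps
  have key := inner_iteratedDeriv_eq isOpen_ball hFc hF (h c hc) j (j + d + 1) 0
    (mem_ball_self one_pos)
  rw [iteratedDeriv_comp_mul_left, iteratedDeriv_comp_mul_left] at key
  simp only [mul_zero, inner_smul_left, inner_smul_right] at key
  have hcc : (starRingEnd ℂ) (c ^ j) * c ^ j = 1 := by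
    rw [← Complex.normSq_eq_conj_mul_self, Complex.normSq_eq_norm_sq, norm_pow, hc]; simp
  rw [show j + d + 1 = j + (d + 1) by ring] at key ⊢
  rw [pow_add, hcd] at key
  set z := inner ℂ (iteratedDeriv j F 0) (iteratedDeriv (j + (d + 1)) F 0)
  linear_combination (-1 / 2 : ℂ) * key - 1 / 2 * z * hcc

end Polarization

/-! ### Automorphisms of the ball: transitivity and the Schwarz lemma. -/

section Automorphisms

variable {N : ℕ}

/-- The centre of the ball. -/
def origin (n : ℕ) : Ball n := ⟨0, mem_ball_self one_pos⟩

/-- The hyperbolic translation of the ball along the unit vector `u`, taking `0` to `r • u`. -/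
noncomputable def moebius (u : E N) (r : ℝ) (z : E N) : E N :=
  (1 + r * inner ℂ u z : ℂ)⁻¹ •
    ((Real.sqrt (1 - r ^ 2) : ℂ) • z + ((1 - Real.sqrt (1 - r ^ 2)) * inner ℂ u z + r : ℂ) • u)

theorem one_sub_sq_pos {r : ℝ} (hr : |r| < 1) : 0 < 1 - r ^ 2 := by
  have := (sq_lt_one_iff_abs_lt_one r).2 hr
  linarith

theorem one_add_mul_inner_ne_zero {u : E N} (hu : ‖u‖ = 1) {r : ℝ} (hr : |r| < 1) {z : E N}
    (hz : ‖z‖ < 1) : (1 + r * inner ℂ u z : ℂ) ≠ 0 := by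
  intro h
  have h1 : ‖(r * inner ℂ u z : ℂ)‖ < 1 := by
    rw [norm_mul, Complex.norm_real, Real.norm_eq_abs]
    have := norm_inner_le_norm (𝕜 := ℂ) u z
    rw [hu, one_mul] at this
    nlinarith [abs_nonneg r, norm_nonneg (inner ℂ u z)]
  rw [eq_neg_of_add_eq_zero_right h, norm_neg, norm_one] at h1
  exact lt_irrefl _ h1

theorem inner_self_of_norm_eq_one {u : E N} (hu : ‖u‖ = 1) : inner ℂ u u = 1 := by
  rw [inner_self_eq_norm_sq_to_K, hu]; simp

theorem norm_moebius_lt_one {u : E N} (hu : ‖u‖ = 1) {r : ℝ} (hr : |r| < 1) {z : E N}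
    (hz : ‖z‖ < 1) : ‖moebius u r z‖ < 1 := by
  have hd := one_add_mul_inner_ne_zero hu hr hz
  have hs := Real.sq_sqrt (one_sub_sq_pos hr).le
  rw [moebius, norm_smul, norm_inv, inv_mul_lt_one₀ (norm_pos_iff.2 hd),
    ← sq_lt_sq₀ (norm_nonneg _) (norm_nonneg _)]
  set s := Real.sqrt (1 - r ^ 2)
  set a := inner ℂ u z with ha
  have ha' : inner ℂ z u = (starRingEnd ℂ) a := by rw [ha, inner_conj_symm]
  -- The denominator and numerator are the image of `(1, z)` under a boost of `ℂ ⊕ ℂᴺ` that scales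
  -- the indefinite form `|t|² - ‖z‖²` by `1 - r²`.
  have key : ‖(1 + r * a : ℂ)‖ ^ 2 - ‖(s : ℂ) • z + ((1 - s) * a + r : ℂ) • u‖ ^ 2 =
      (1 - r ^ 2) * (1 - ‖z‖ ^ 2) := by
    rw [@norm_add_sq ℂ (E N), norm_smul, norm_smul, hu, inner_smul_left, inner_smul_right, ha',
      mul_pow, mul_one, Complex.norm_real, Real.norm_eq_abs, sq_abs, hs,
      ← Complex.normSq_eq_norm_sq, ← Complex.normSq_eq_norm_sq]
    simp only [Complex.normSq_apply, Complex.conj_ofReal, Complex.add_re, Complex.add_im,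
      Complex.mul_re, Complex.mul_im, Complex.one_re, Complex.one_im, Complex.ofReal_re,
      Complex.ofReal_im, Complex.sub_re, Complex.sub_im, Complex.conj_re, Complex.conj_im,
      RCLike.re_to_complex]
    linear_combination (a.re ^ 2 + a.im ^ 2) * hs
  have : 0 < (1 - r ^ 2) * (1 - ‖z‖ ^ 2) :=
    mul_pos (one_sub_sq_pos hr) (by nlinarith [norm_nonneg z])
  linarith

theorem moebius_neg_moebius {u : E N} (hu : ‖u‖ = 1) {r : ℝ} (hr : |r| < 1) {z : E N}
    (hz : ‖z‖ < 1) : moebius u (-r) (moebius u r z) = z := by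
  have hd := one_add_mul_inner_ne_zero hu hr hz
  have hs : ((Real.sqrt (1 - r ^ 2) : ℂ)) ^ 2 = 1 - r ^ 2 := by
    rw [← Complex.ofReal_pow, Real.sq_sqrt (one_sub_sq_pos hr).le]; push_cast; rfl
  have hs0 : (Real.sqrt (1 - r ^ 2) : ℂ) ≠ 0 := by
    exact_mod_cast (Real.sqrt_pos.2 (one_sub_sq_pos hr)).ne'
  have hin : inner ℂ u (moebius u r z) = (1 + r * inner ℂ u z)⁻¹ * (inner ℂ u z + r) := by
    rw [moebius, inner_smul_right, inner_add_right, inner_smul_right, inner_smul_right,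
      inner_self_of_norm_eq_one hu]
    ring
  rw [moebius, hin]
  simp only [moebius, neg_sq]
  set s : ℂ := (Real.sqrt (1 - r ^ 2) : ℂ)
  set a := inner ℂ u z
  have hden : (1 + ((-r : ℝ) : ℂ) * ((1 + r * a)⁻¹ * (a + r)) : ℂ) = s ^ 2 * (1 + r * a)⁻¹ := by
    rw [hs]; push_cast; field_simp; ring
  rw [hden]
  have h1 : (s ^ 2 * (1 + r * a)⁻¹)⁻¹ * (s * (1 + r * a)⁻¹ * s) = 1 := by field_simp
  have h2 : (s ^ 2 * (1 + r * a)⁻¹)⁻¹ * (s * (1 + r * a)⁻¹ * ((1 - s) * a + r) +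
      ((1 - s) * ((1 + r * a)⁻¹ * (a + r)) + ((-r : ℝ) : ℂ))) = 0 := by
    push_cast
    field_simp
    linear_combination (-a) * hs
  -- The composite is a combination of `z` and `u`; `h1` and `h2` say that its coefficients are `1`
  -- and `0`.
  calc _ = ((s ^ 2 * (1 + r * a)⁻¹)⁻¹ * (s * (1 + r * a)⁻¹ * s)) • z +
        ((s ^ 2 * (1 + r * a)⁻¹)⁻¹ * (s * (1 + r * a)⁻¹ * ((1 - s) * a + r) +
      ((1 - s) * ((1 + r * a)⁻¹ * (a + r)) + ((-r : ℝ) : ℂ)))) • u := by module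
    _ = z := by rw [h1, h2, one_smul, zero_smul, add_zero]

theorem differentiableOn_moebius {u : E N} (hu : ‖u‖ = 1) {r : ℝ} (hr : |r| < 1) :
    DifferentiableOn ℂ (moebius u r) (ball 0 1) := by
  have hi : Differentiable ℂ fun z : E N => (inner ℂ u z : ℂ) := (innerSL ℂ u : E N →L[ℂ] ℂ).differentiable
  have h1 : DifferentiableOn ℂ (fun z : E N => (1 + r * inner ℂ u z : ℂ)⁻¹) (ball 0 1) :=
    ((hi.const_mul _).const_add _).differentiableOn.fun_inv fun z hz =>
      one_add_mul_inner_ne_zero hu hr (mem_ball_zero_iff.1 hz)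
  have h2 : Differentiable ℂ (fun z : E N => (Real.sqrt (1 - r ^ 2) : ℂ) • z +
      ((1 - Real.sqrt (1 - r ^ 2)) * inner ℂ u z + r : ℂ) • u) := by fun_prop
  exact h1.smul h2.differentiableOn

/-- The hyperbolic translation `moebius u r` as an automorphism of the ball. -/
noncomputable def moebiusAut {u : E N} (hu : ‖u‖ = 1) {r : ℝ} (hr : |r| < 1) : Aut N :=
  ⟨{  toFun := fun z => ⟨moebius u r z,
        mem_ball_zero_iff.2 (norm_moebius_lt_one hu hr (mem_ball_zero_iff.1 z.2))⟩
      invFun := fun z => ⟨moebius u (-r) z, mem_ball_zero_iff.2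
        (norm_moebius_lt_one hu (by rwa [abs_neg]) (mem_ball_zero_iff.1 z.2))⟩
      left_inv := fun z => Subtype.ext (moebius_neg_moebius hu hr (mem_ball_zero_iff.1 z.2))
      right_inv := fun z => Subtype.ext <| by
        have := moebius_neg_moebius hu (r := -r) (by rwa [abs_neg]) (mem_ball_zero_iff.1 z.2)
        rwa [neg_neg] at this },
    ⟨moebius u r, differentiableOn_moebius hu hr, fun _ => rfl⟩,
    ⟨moebius u (-r), differentiableOn_moebius hu (by rwa [abs_neg]), fun _ => rfl⟩⟩

/-- The automorphism group of the ball acts transitively. -/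
theorem exists_aut_apply_origin (b : Ball N) : ∃ χ : Aut N, χ.1 (origin N) = b := by
  by_cases hb : (b : E N) = 0
  · exact ⟨1, Subtype.ext hb.symm⟩
  have hb' : ‖(b : E N)‖ ≠ 0 := norm_ne_zero_iff.2 hb
  have hu : ‖((‖(b : E N)‖ : ℂ)⁻¹ • (b : E N))‖ = 1 := by
    rw [norm_smul, norm_inv, Complex.norm_real, norm_norm, inv_mul_cancel₀ hb']
  have hr : |‖(b : E N)‖| < 1 := by rw [abs_norm]; exact mem_ball_zero_iff.1 b.2
  refine ⟨moebiusAut hu hr, Subtype.ext ?_⟩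
  change moebius _ _ (0 : E N) = b
  simp [moebius, smul_smul, hb]

/-- The Schwarz lemma. Applied to an automorphism fixing `0` and to its inverse, it gives equality
of norms. -/
theorem Holomorphic.norm_le_norm {f : Ball N → Ball N} (hf : Holomorphic f)
    (h0 : f (origin N) = origin N) (z : Ball N) : ‖(f z : E N)‖ ≤ ‖(z : E N)‖ := by
  obtain ⟨F, hF, hFf⟩ := hf
  rw [← hFf]
  refine Complex.norm_le_norm_of_mapsTo_ball hF (fun w hw => ?_) ?_ (mem_ball_zero_iff.1 z.2)
  · rw [hFf ⟨w, hw⟩]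
    exact ball_subset_closedBall (f ⟨w, hw⟩).2
  · exact (hFf (origin N)).trans (congrArg Subtype.val h0)

/-- An automorphism of the ball which fixes the centre preserves the norm. -/
theorem norm_aut_apply_of_fixes_origin (ψ : Aut N) (h0 : ψ.1 (origin N) = origin N) (z : Ball N) :
    ‖(ψ.1 z : E N)‖ = ‖(z : E N)‖ := by
  refine le_antisymm (ψ.2.1.norm_le_norm h0 z) ?_
  have := ψ.2.2.norm_le_norm (by rw [Equiv.symm_apply_eq, h0]) (ψ.1 z)
  rwa [Equiv.symm_apply_apply] at this

theorem Holomorphic.continuous {n : ℕ} {f : Ball n → Ball N} (hf : Holomorphic f) :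
    Continuous f := by
  obtain ⟨F, hF, hFf⟩ := hf
  refine Continuous.subtype_mk (f := fun z => (f z : E N)) ?_ fun z => (f z).2
  simp only [← hFf]
  exact continuousOn_iff_continuous_domRestrict.1 hF.continuousOn

/-- An automorphism of the ball as a homeomorphism. -/
def autHomeomorph (ψ : Aut N) : Ball N ≃ₜ Ball N where
  toEquiv := ψ.1
  continuous_toFun := ψ.2.1.continuous
  continuous_invFun := ψ.2.2.continuous

end Automorphisms

/-! ### The Gram kernel and the linear span of tensor juxtapositions. -/

section Tensors

variable {n N : ℕ}

/-- The multinomial theorem; the weights `√(m! / α!)` are chosen so that their squares are its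
coefficients. -/
theorem inner_tensorPower (m : ℕ) (z w : E n) :
    inner ℂ (tensorPower m z) (tensorPower m w) = inner ℂ z w ^ m := by
  rw [PiLp.inner_apply, PiLp.inner_apply, Finset.sum_pow, Finset.sym_univ]
  refine Finset.sum_congr rfl fun s _ => ?_
  change _ = (((s : Multiset (Fin n)).countPerms : ℕ) : ℂ) *
    ((s : Multiset (Fin n)).map fun i => inner ℂ (z i) (w i)).prod
  simp only [tensorPower, RCLike.inner_apply, map_mul, Complex.conj_ofReal, map_multiset_prod,
    Multiset.map_map, Function.comp_def, Multiset.prod_map_mul]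
  have h := Real.mul_self_sqrt (Nat.cast_nonneg (α := ℝ) (s : Multiset (Fin n)).countPerms)
  have h' := congrArg (Complex.ofReal) h
  push_cast at h'
  rw [← h']
  ring

theorem tensorSum_apply {k : ℕ} (m : Fin k → ℕ) (lam : Fin k → ℂ)
    (e : (Σ j : Fin k, Sym (Fin n) (m j)) ↪ Fin N) (z : E n) (s) :
    tensorSum m lam e z (e s) = lam s.1 * tensorPower (m s.1) z s.2 := by
  simp only [tensorSum, e.injective.extend_apply]

theorem inner_right_tensorSum {k : ℕ} (m : Fin k → ℕ) (lam : Fin k → ℂ)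
    (e : (Σ j : Fin k, Sym (Fin n) (m j)) ↪ Fin N) (v : E N) (z : E n) :
    inner ℂ v (tensorSum m lam e z) =
      ∑ s, inner ℂ (v (e s)) (lam s.1 * tensorPower (m s.1) z s.2) := by
  rw [PiLp.inner_apply]
  refine (Fintype.sum_of_injective e e.injective _ _ (fun i hi => ?_) fun s => ?_).symm
  · change inner ℂ (v i) (Function.extend e _ _ i) = 0
    rw [Function.extend_apply' _ _ _ hi, inner_zero_right]
  · rw [tensorSum_apply]

theorem inner_tensorSum {k : ℕ} (m : Fin k → ℕ) (lam : Fin k → ℂ)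
    (e : (Σ j : Fin k, Sym (Fin n) (m j)) ↪ Fin N) (z w : E n) :
    inner ℂ (tensorSum m lam e z) (tensorSum m lam e w) =
      ∑ j, (‖lam j‖ ^ 2 : ℂ) * inner ℂ z w ^ m j := by
  rw [inner_right_tensorSum, Fintype.sum_sigma]
  refine Finset.sum_congr rfl fun j _ => ?_
  rw [← inner_tensorPower, PiLp.inner_apply, Finset.mul_sum]
  refine Finset.sum_congr rfl fun s _ => ?_
  rw [tensorSum_apply, ← Complex.ofReal_pow, ← Complex.normSq_eq_norm_sq,
    Complex.normSq_eq_conj_mul_self]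
  simp only [RCLike.inner_apply, map_mul]
  ring

/-- A vector orthogonal to the image yields a polynomial vanishing on the ball. Injectivity of `m`
keeps the monomials of different summands distinct, so the coefficients, and with them the
coordinates of the vector, all vanish. -/
theorem span_tensorSum_eq_top {k : ℕ} {m : Fin k → ℕ} (hm : Function.Injective m)
    {lam : Fin k → ℂ} (hlam : ∀ j, lam j ≠ 0)
    {e : (Σ j : Fin k, Sym (Fin n) (m j)) ↪ Fin N} (he : Function.Surjective e) :
    Submodule.span ℂ (range fun z : Ball n => tensorSum m lam e z) = ⊤ := by
  rw [← Submodule.orthogonal_eq_bot_iff, Submodule.eq_bot_iff]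
  intro v hv
  let ex : (Σ j : Fin k, Sym (Fin n) (m j)) → (Fin n →₀ ℕ) :=
    fun s => Multiset.toFinsupp (s.2 : Multiset (Fin n))
  have hex : Function.Injective ex := by
    rintro ⟨j, s⟩ ⟨j', s'⟩ h
    have h : (s : Multiset (Fin n)) = s' := Multiset.toFinsupp.injective h
    obtain rfl : j = j' := hm (by rw [← s.2, ← s'.2]; exact congrArg Multiset.card h)
    rw [Sym.coe_injective h]
  let coe : (Σ j : Fin k, Sym (Fin n) (m j)) → ℂ := fun s =>
    (starRingEnd ℂ) (v (e s)) *
      (lam s.1 * (Real.sqrt ((s.2 : Multiset (Fin n)).countPerms : ℝ) : ℂ))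
  let p : MvPolynomial (Fin n) ℂ := ∑ s, MvPolynomial.monomial (ex s) (coe s)
  have hp : p = 0 := by
    have hnhds : {x : Fin n → ℂ | WithLp.toLp 2 x ∈ ball (0 : E n) 1} ∈ nhds 0 :=
      (isOpen_ball.preimage (PiLp.continuous_toLp 2 _)).mem_nhds (by simp)
    obtain ⟨δ, hδ, hb⟩ := Metric.mem_nhds_iff.1 hnhds
    -- A polydisc inside the ball is a product of infinite sets, which is enough to make the
    -- polynomial zero.
    refine MvPolynomial.funext_set (fun _ => ball (0 : ℂ) δ)
      (fun _ => infinite_of_mem_nhds 0 (ball_mem_nhds 0 hδ)) fun x hx => ?_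
    have hx1 : WithLp.toLp 2 x ∈ ball (0 : E n) 1 := by
      refine hb ?_
      rw [ball_pi _ hδ]
      exact hx
    have h0 := (Submodule.mem_orthogonal' _ _).1 hv _
      (Submodule.subset_span ⟨⟨WithLp.toLp 2 x, hx1⟩, rfl⟩)
    rw [inner_right_tensorSum] at h0
    rw [map_zero, ← h0, map_sum]
    refine Finset.sum_congr rfl fun s _ => ?_
    rw [MvPolynomial.eval_monomial]
    have hprod : (ex s).prod (fun i a => x i ^ a) =
        ((s.2 : Multiset (Fin n)).map fun i => x i).prod := by
      rw [Finset.prod_multiset_map_count, Finsupp.prod, Multiset.toFinsupp_support]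
      simp only [ex, Multiset.toFinsupp_apply]
    rw [hprod]
    simp only [tensorPower, coe, RCLike.inner_apply]
    ring
  have hv0 (s) : v (e s) = 0 := by
    have h1 : p.coeff (ex s) = coe s := by
      simp only [p, MvPolynomial.coeff_sum, MvPolynomial.coeff_monomial, hex.eq_iff]
      simp
    rw [hp, MvPolynomial.coeff_zero] at h1
    have hc : (Real.sqrt ((s.2 : Multiset (Fin n)).countPerms : ℝ) : ℂ) ≠ 0 := by
      have : 0 < (s.2 : Multiset (Fin n)).countPerms := Nat.multinomial_pos _ _
      exact_mod_cast (Real.sqrt_pos.2 (Nat.cast_pos.2 this)).ne'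
    simpa [coe, hlam, hc] using h1.symm
  ext i
  obtain ⟨s, rfl⟩ := he i
  exact hv0 s

/-- A map with the Gram kernel of a tensor juxtaposition needs as many coordinates as it. -/
theorem card_sigma_sym_le {k : ℕ} {m : Fin k → ℕ} (hm : Function.Injective m)
    {lam : Fin k → ℂ} (hlam : ∀ j, lam j ≠ 0) {g : Ball n → E N}
    (hg : ∀ z w : Ball n, inner ℂ (g z) (g w) =
      ∑ j, (‖lam j‖ ^ 2 : ℂ) * inner ℂ (z : E n) (w : E n) ^ m j) :
    Fintype.card (Σ j : Fin k, Sym (Fin n) (m j)) ≤ N := by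
  let e := Fintype.equivFin (Σ j : Fin k, Sym (Fin n) (m j))
  obtain ⟨L, -⟩ := exists_linearIsometry_span (a := fun z : Ball n => tensorSum m lam
    e.toEmbedding z) (b := g) (fun z w => by rw [inner_tensorSum, hg])
  have h := LinearMap.finrank_le_finrank_of_injective (f := L.toLinearMap) L.injective
  rwa [span_tensorSum_eq_top hm hlam e.surjective, finrank_top, finrank_euclideanSpace_fin,
    finrank_euclideanSpace_fin] at h

end Tensors

/-! ### Kernels of unitarily invariant proper maps. -/

section Classification

variable {n N : ℕ}

theorem IsRational.holomorphic {f : Ball n → Ball N} (hf : IsRational f) : Holomorphic f := by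
  obtain ⟨p, q, h⟩ := hf
  have hd (P : MvPolynomial (Fin n) ℂ) :
      Differentiable ℂ fun z : E n => MvPolynomial.eval (fun i => z i) P := by
    induction P using MvPolynomial.induction_on with
    | C a => simp
    | add p q hp hq => simp only [map_add]; exact hp.add hq
    | mul_X p i hp => simp only [map_mul, MvPolynomial.eval_X]; fun_prop
  refine ⟨fun z => WithLp.toLp 2 fun i => MvPolynomial.eval (fun i => z i) (p i) /
    MvPolynomial.eval (fun i => z i) q, ?_, fun z => ?_⟩
  · rw [differentiableOn_euclidean]
    simp only [div_eq_mul_inv]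
    exact fun i => (hd (p i)).differentiableOn.mul
      ((hd q).differentiableOn.fun_inv fun z hz => (h ⟨z, hz⟩).1)
  · ext i
    exact ((h z).2 i).symm

theorem differentiable_tensorSum {k : ℕ} (m : Fin k → ℕ) (lam : Fin k → ℂ)
    (e : (Σ j : Fin k, Sym (Fin n) (m j)) ↪ Fin N) :
    Differentiable ℂ (tensorSum (N := N) m lam e) := by
  rw [differentiable_euclidean]
  intro i
  by_cases hi : ∃ s, e s = i
  · obtain ⟨s, rfl⟩ := hi
    simp only [tensorSum_apply, tensorPower, Finset.prod_multiset_map_count]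
    fun_prop
  · have : (fun z : E n => tensorSum m lam e z i) = fun _ => 0 := by
      funext z
      simp only [tensorSum, Function.extend_apply' _ _ _ hi]
    rw [this]
    exact differentiable_const 0

theorem not_isCompact_ball (hn : 1 ≤ n) : ¬ IsCompact (ball (0 : E n) 1) := by
  intro h
  have h1 : closedBall (0 : E n) 1 = ball 0 1 := by
    rw [← closure_ball 0 one_ne_zero, h.isClosed.closure_eq]
  have h2 : (EuclideanSpace.single ⟨0, hn⟩ 1 : E n) ∈ closedBall (0 : E n) 1 := by simp
  rw [h1] at h2
  simp at h2

/-- A proper map between balls has no smaller concentric ball containing its values. -/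
theorem one_le_of_isProperMap_of_norm_le (hn : 1 ≤ n) {g : Ball n → Ball N} (hg : IsProperMap g)
    {ρ : ℝ} (h : ∀ z, ‖(g z : E N)‖ ≤ ρ) : 1 ≤ ρ := by
  by_contra! hρ
  -- For `ρ < 1` this set is compact in the open ball, yet its preimage is the whole noncompact
  -- source.
  have hK : IsCompact {w : Ball N | ‖(w : E N)‖ ≤ ρ} := by
    have : Subtype.val '' {w : Ball N | ‖(w : E N)‖ ≤ ρ} = closedBall (0 : E N) ρ :=
      Subset.antisymm (by rintro _ ⟨w, hw, rfl⟩; exact mem_closedBall_zero_iff.2 hw)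
        fun w hw => ⟨⟨w, closedBall_subset_ball hρ hw⟩, mem_closedBall_zero_iff.1 hw, rfl⟩
    rw [Subtype.isCompact_iff, this]
    exact isCompact_closedBall (0 : E N) ρ
  have h1 := hg.isCompact_preimage hK
  rw [eq_univ_of_forall (s := g ⁻¹' {w : Ball N | ‖(w : E N)‖ ≤ ρ}) h, Subtype.isCompact_iff, image_univ,
    Subtype.range_coe] at h1
  exact not_isCompact_ball hn h1

theorem norm_sq_sum_of_orthogonal {ι V : Type*} [NormedAddCommGroup V] [InnerProductSpace ℂ V]
    (S : Finset ι) (v : ι → V) (h : ∀ i j, i ≠ j → inner ℂ (v i) (v j) = 0) :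
    ‖∑ i ∈ S, v i‖ ^ 2 = ∑ i ∈ S, ‖v i‖ ^ 2 := by
  classical
  induction S using Finset.induction_on with
  | empty => simp
  | insert a S ha ih =>
    rw [Finset.sum_insert ha, Finset.sum_insert ha, ← ih, @norm_add_sq ℂ, inner_sum,
      Finset.sum_eq_zero fun i hi => h a i (ne_of_mem_of_not_mem hi ha).symm]
    simp

/-- A rotation invariant holomorphic curve in a finite-dimensional space is polynomial, with
orthogonal coefficients. -/
theorem exists_norm_sq_eq_sum {γ : ℂ → E N} (hγ : DifferentiableOn ℂ γ (ball 0 1))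
    (h : ∀ c : ℂ, ‖c‖ = 1 → ∀ t ∈ ball (0 : ℂ) 1, ‖γ (c * t)‖ = ‖γ t‖) :
    ∃ (S : Finset ℕ) (b : ℕ → ℝ), (∀ j ∈ S, 0 < b j) ∧
      ∀ t ∈ ball (0 : ℂ) 1, ‖γ t‖ ^ 2 = ∑ j ∈ S, b j ^ 2 * (‖t‖ ^ 2) ^ j := by
  -- Nonzero pairwise orthogonal vectors are linearly independent, so finite dimension bounds their
  -- number.
  have hfin : {j | iteratedDeriv j γ 0 ≠ 0}.Finite := by
    have hli : LinearIndependent ℂ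
        fun j : {j | iteratedDeriv j γ 0 ≠ 0} => iteratedDeriv (j : ℕ) γ 0 :=
      linearIndependent_of_ne_zero_of_inner_eq_zero (𝕜 := ℂ) (fun j => j.2) fun i j hij =>
        inner_iteratedDeriv_eq_zero hγ h fun hij' => hij (Subtype.ext hij')
    exact hli.finite_of_isNoetherian
  refine ⟨hfin.toFinset, fun j => ‖((j.factorial : ℂ)⁻¹ • iteratedDeriv j γ 0)‖, fun j hj => ?_,
    fun t ht => ?_⟩
  · rw [norm_pos_iff]
    exact smul_ne_zero (inv_ne_zero (by exact_mod_cast j.factorial_ne_zero))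
      (hfin.mem_toFinset.1 hj)
  · have h1 := Complex.hasSum_taylorSeries_on_ball hγ ht
    have h2 := hasSum_sum_of_ne_finset_zero (L := .unconditional ℕ) (s := hfin.toFinset)
      (f := fun j : ℕ => (j.factorial : ℂ)⁻¹ • (t - 0) ^ j • iteratedDeriv j γ 0) (by
        intro j hj
        have : iteratedDeriv j γ 0 = 0 := by simpa using hj
        rw [this, smul_zero, smul_zero])
    rw [h1.unique h2, norm_sq_sum_of_orthogonal]
    · refine Finset.sum_congr rfl fun j _ => ?_
      simp only [norm_smul, sub_zero, norm_pow]
      ring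
    · intro i j hij
      simp [inner_iteratedDeriv_eq_zero hγ h hij]

/-- The Gram kernel of a unitarily invariant proper holomorphic map between balls. -/
theorem exists_inner_eq_sum (hn : 1 ≤ n) {g : Ball n → Ball N} (hg : Holomorphic g)
    (hp : IsProperMap g)
    (hinv : ∀ (U : E n ≃ₗᵢ[ℂ] E n) z, ‖(g (unitaryPerm U z) : E N)‖ = ‖(g z : E N)‖) :
    ∃ (k : ℕ) (m : Fin k → ℕ) (lam : Fin k → ℝ), StrictMono m ∧ (∀ j, 0 < lam j) ∧
      ∑ j, lam j ^ 2 = 1 ∧ ∀ z w : Ball n, inner ℂ (g z : E N) (g w : E N) =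
        ∑ j, (‖(lam j : ℂ)‖ ^ 2 : ℂ) * inner ℂ (z : E n) (w : E n) ^ m j := by
  obtain ⟨F, hF, hFg⟩ := hg
  have hFinv (z w : E n) (hz : ‖z‖ < 1) (hzw : ‖z‖ = ‖w‖) : ‖F w‖ = ‖F z‖ := by
    obtain ⟨U, rfl⟩ := exists_linearIsometryEquiv_of_norm_eq hzw
    have hz' := mem_ball_zero_iff.2 hz
    rw [hFg ⟨z, hz'⟩, ← hinv U, ← hFg]
    rfl
  set u : E n := EuclideanSpace.single ⟨0, hn⟩ 1 with hu
  have hun : ‖u‖ = 1 := by simp [hu]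
  have hmaps : MapsTo (fun t : ℂ => t • u) (ball 0 1) (ball 0 1) := by
    intro t ht
    simpa [norm_smul, hun] using ht
  obtain ⟨S, b, hb, hS⟩ := exists_norm_sq_eq_sum (γ := fun t : ℂ => F (t • u))
    (hF.comp (by fun_prop) hmaps) (fun c hc t ht => by
      refine hFinv _ _ (mem_ball_zero_iff.1 (hmaps ht)) ?_
      simp [norm_smul, hc])
  have hFS (z : E n) (hz : ‖z‖ < 1) : ‖F z‖ ^ 2 = ∑ j ∈ S, b j ^ 2 * (‖z‖ ^ 2) ^ j := by
    have h1 : ‖((‖z‖ : ℂ) • u)‖ = ‖z‖ := by simp [norm_smul, hun]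
    rw [hFinv _ z (by rwa [h1]) h1, hS _ (by simpa using hz)]
    simp
  -- The upper bound lets the radius tend to `1`; the lower bound is properness, since `‖g z‖² ≤ ∑
  -- b_j²`.
  have hsum : ∑ j ∈ S, b j ^ 2 = 1 := by
    refine le_antisymm ?_ ?_
    · have hcont : Continuous fun r : ℝ => ∑ j ∈ S, b j ^ 2 * (r ^ 2) ^ j := by fun_prop
      have ht : Filter.Tendsto (fun r : ℝ => ∑ j ∈ S, b j ^ 2 * (r ^ 2) ^ j)
          (nhdsWithin 1 (Iio 1)) (nhds (∑ j ∈ S, b j ^ 2)) := by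
        simpa using (hcont.tendsto 1).mono_left nhdsWithin_le_nhds
      refine le_of_tendsto ht ?_
      filter_upwards [Ioo_mem_nhdsLT (zero_lt_one (α := ℝ))] with r hr
      have hr' : ‖((r : ℂ) • u)‖ = r := by
        simp [norm_smul, hun, abs_of_pos hr.1]
      have h1 := hFS ((r : ℂ) • u) (hr'.trans_lt hr.2)
      rw [hr'] at h1
      rw [← h1, hFg ⟨(r : ℂ) • u, mem_ball_zero_iff.2 (hr'.trans_lt hr.2)⟩]
      exact pow_le_one₀ (norm_nonneg _) (mem_ball_zero_iff.1 (g _).2).le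
    · rw [← Real.one_le_sqrt]
      refine one_le_of_isProperMap_of_norm_le hn hp fun z => Real.le_sqrt_of_sq_le ?_
      have hz := mem_ball_zero_iff.1 z.2
      rw [← hFg, hFS _ hz]
      refine Finset.sum_le_sum fun j _ => mul_le_of_le_one_right (sq_nonneg _) ?_
      exact pow_le_one₀ (sq_nonneg _) (pow_le_one₀ (norm_nonneg _) hz.le)
  have hreindex (φ : ℕ → ℝ) : ∑ j : Fin S.card, φ (S.orderEmbOfFin rfl j) = ∑ j ∈ S, φ j := by
    rw [← Finset.sum_coe_sort S, ← (S.orderIsoOfFin rfl).toEquiv.sum_comp]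
    rfl
  refine ⟨S.card, S.orderEmbOfFin rfl, fun j => b (S.orderEmbOfFin rfl j),
    (S.orderEmbOfFin rfl).strictMono, fun j => hb _ (S.orderEmbOfFin_mem rfl j),
    (hreindex fun j => b j ^ 2).trans hsum, fun z w => ?_⟩
  -- The comparison juxtaposition lives in its own space, of exactly the dimension it needs, so
  -- polarization does not require it to fit into `ℂᴺ`.
  let e := Fintype.equivFin (Σ j : Fin S.card, Sym (Fin n) (S.orderEmbOfFin rfl j))
  have hG := inner_tensorSum (n := n) (S.orderEmbOfFin rfl)
    (fun j => (b (S.orderEmbOfFin rfl j) : ℂ)) e.toEmbedding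
  rw [← hG, ← hFg, ← hFg]
  refine inner_eq_of_norm_eq_of_convex isOpen_ball (convex_ball 0 1) hF
    (differentiable_tensorSum _ _ _).differentiableOn (fun x hx => ?_) z.2 w.2
  rw [← sq_eq_sq₀ (norm_nonneg _) (norm_nonneg _), hFS x (mem_ball_zero_iff.1 hx),
    ← hreindex fun j => b j ^ 2 * (‖x‖ ^ 2) ^ j]
  have hx2 := hG x x
  rw [inner_self_eq_norm_sq_to_K, inner_self_eq_norm_sq_to_K] at hx2
  simp only [Complex.norm_real, Real.norm_eq_abs, Complex.coe_algebraMap] at hx2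
  have hx3 := Complex.ofReal_injective (a₁ := _ ^ 2)
    (a₂ := ∑ j, |b (S.orderEmbOfFin rfl j)| ^ 2 * (‖x‖ ^ 2) ^ S.orderEmbOfFin rfl j)
    (by push_cast; exact hx2)
  rw [hx3]
  simp only [sq_abs]

end Classification

/-! ### The two implications. -/

section Equivalence

variable {n N k : ℕ}

theorem containsConjugateOfUnitary_of_isTensorJuxtaposition {m : Fin k → ℕ} {lam : Fin k → ℂ}
    {f g : Ball n → Ball N} (hg : IsTensorJuxtaposition m lam g)
    (hfg : SphericallyEquivalent f g) :
    ContainsConjugateOfUnitary (hermitianInvariantGroup f) := by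
  obtain ⟨-, e, he⟩ := hg
  obtain ⟨φ, χ, h⟩ := hfg
  refine ⟨φ⁻¹, ?_⟩
  rintro _ ⟨_, ⟨U, rfl⟩, rfl⟩
  -- The kernel depends on `z` and `w` only through `⟪z, w⟫`, so composing with `U` does not change
  -- it.
  obtain ⟨V, hV⟩ := exists_linearIsometryEquiv_of_inner_eq (ι := E n) (a := tensorSum m lam e)
    (b := fun z => tensorSum m lam e (U z)) fun z w => by
      rw [inner_tensorSum, inner_tensorSum, U.inner_map_map]
  refine ⟨χ * unitaryHom N V * χ⁻¹, fun z => ?_⟩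
  have hgU (z : Ball n) : g (unitaryPerm U z) = unitaryPerm V (g z) := by
    apply Subtype.ext
    change _ = V (g z)
    rw [he, he, hV]
    rfl
  change f (φ.1.symm (unitaryPerm U (φ.1 z))) = χ.1 (unitaryPerm V (χ.1.symm (f z)))
  rw [h, h, Equiv.apply_symm_apply, Equiv.symm_apply_apply, hgU]

theorem exists_isTensorJuxtaposition (hn : 1 ≤ n) {f : Ball n → Ball N} (hf : Holomorphic f)
    (hp : IsProperMap f) (hΓ : ContainsConjugateOfUnitary (hermitianInvariantGroup f)) :
    ∃ (k : ℕ) (m : Fin k → ℕ) (lam : Fin k → ℝ) (g : Ball n → Ball N),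
      1 ≤ k ∧ StrictMono m ∧ (∀ j, 0 < lam j) ∧
        IsTensorJuxtaposition m (fun j => (lam j : ℂ)) g ∧ SphericallyEquivalent f g := by
  obtain ⟨φ, hφ⟩ := hΓ
  -- Normalization: `φ` makes the invariance group contain `U(n)` itself, and `χ` moves the value at
  -- `0` back to `0`.
  obtain ⟨χ, hχ⟩ := exists_aut_apply_origin (f (φ.1 (origin n)))
  set h : Ball n → Ball N := fun z => χ.1.symm (f (φ.1 z)) with hh
  have h0 : h (origin n) = origin N := by rw [hh, Equiv.symm_apply_eq, hχ]
  have hhol : Holomorphic h := χ.2.2.comp (hf.comp φ.2.1)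
  have hprop : IsProperMap h := (autHomeomorph χ).symm.isProperMap.comp
    (hp.comp (autHomeomorph φ).isProperMap)
  have hinv (U : E n ≃ₗᵢ[ℂ] E n) (z : Ball n) :
      ‖(h (unitaryPerm U z) : E N)‖ = ‖(h z : E N)‖ := by
    obtain ⟨ψ, hψ⟩ := hφ ⟨unitaryHom n U, ⟨U, rfl⟩, rfl⟩
    have hψh (z : Ball n) : h (unitaryPerm U z) = (χ⁻¹ * ψ * χ).1 (h z) := by
      have h1 := hψ (φ.1 z)
      change f (φ.1 (unitaryPerm U (φ.1.symm (φ.1 z)))) = _ at h1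
      rw [Equiv.symm_apply_apply] at h1
      change χ.1.symm (f (φ.1 (unitaryPerm U z))) = χ.1.symm (ψ.1 (χ.1 (χ.1.symm (f (φ.1 z)))))
      rw [h1, Equiv.apply_symm_apply]
    rw [hψh]
    refine norm_aut_apply_of_fixes_origin _ ?_ _
    -- The matching target automorphism fixes `0` because `U` and `h` both do.
    have hU0 : unitaryPerm U (origin n) = origin n := Subtype.ext (map_zero U)
    rw [← h0, ← hψh, hU0]
  obtain ⟨k, m, lam, hm, hlam, hsum, hin⟩ := exists_inner_eq_sum hn hhol hprop hinv
  have hcard := card_sigma_sym_le hm.injective (lam := fun j => (lam j : ℂ))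
    (fun j => by exact_mod_cast (hlam j).ne') hin
  obtain ⟨e⟩ : Nonempty ((Σ j : Fin k, Sym (Fin n) (m j)) ↪ Fin N) :=
    Function.Embedding.nonempty_of_card_le (by rwa [Fintype.card_fin])
  obtain ⟨V, hV⟩ := exists_linearIsometryEquiv_of_inner_eq (a := fun z : Ball n => (h z : E N))
    (b := fun z : Ball n => tensorSum m (fun j => (lam j : ℂ)) e z) fun z w => by
      rw [inner_tensorSum, hin]
  refine ⟨k, m, lam, fun z => unitaryPerm V (h z), ?_, hm, hlam, ⟨?_, e, hV⟩, φ⁻¹,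
    χ * (unitaryHom N V)⁻¹, fun z => ?_⟩
  -- An empty sum of squares could not equal `1`.
  · rw [Nat.one_le_iff_ne_zero]
    rintro rfl
    simp at hsum
  · simpa using hsum
  · change f z = χ.1 ((unitaryPerm V).symm (unitaryPerm V (χ.1.symm (f (φ.1 (φ.1.symm z))))))
    simp

end Equivalence

end CBall

theorem theorem5p2 (n N : ℕ) (hn : 1 ≤ n) (hN : n ≤ N) (f : CBall.Ball n → CBall.Ball N)
    (hrat : CBall.IsRational f) (hproper : IsProperMap f) :
    (CBall.ContainsConjugateOfUnitary (CBall.hermitianInvariantGroup f) ↔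
      ∃ (k : ℕ) (m : Fin k → ℕ) (lam : Fin k → ℂ) (g : CBall.Ball n → CBall.Ball N),
        1 ≤ k ∧ StrictMono m ∧ CBall.IsTensorJuxtaposition m lam g ∧
          CBall.SphericallyEquivalent f g) ∧
    (CBall.ContainsConjugateOfUnitary (CBall.hermitianInvariantGroup f) →
      ∃ (k : ℕ) (m : Fin k → ℕ) (lam : Fin k → ℝ) (g : CBall.Ball n → CBall.Ball N),
        1 ≤ k ∧ StrictMono m ∧ (∀ j, 0 < lam j) ∧
          CBall.IsTensorJuxtaposition m (fun j => (lam j : ℂ)) g ∧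
            CBall.SphericallyEquivalent f g) := by
  have key := CBall.exists_isTensorJuxtaposition hn hrat.holomorphic hproper
  refine ⟨⟨fun h => ?_, ?_⟩, key⟩
  · obtain ⟨k, m, lam, g, hk, hm, -, hg, hfg⟩ := key h
    exact ⟨k, m, fun j => lam j, g, hk, hm, hg, hfg⟩
  · rintro ⟨k, m, lam, g, -, -, hg, hfg⟩
    exact CBall.containsConjugateOfUnitary_of_isTensorJuxtaposition hg hfg
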